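/- For a braid $\beta\in B_n$ ($n\ge 1$) let $\widehat\beta$ be the oriented link obtained as its closure and let $w(\beta)\in\mathbb Z$ be its writhe, i.e. its exponent sum in the standard generators. Let $P_L(v,z)\in\mathbb Z[v^{\pm1},z^{\pm1}]$ be the Homflypt polynomial of an oriented link $L$, normalized by $P_{\mathrm{unknot}}=1$ and by the skein relation $P_{D_+}=vz\,P_{D_0}+v^2P_{D_-}$ (each generator $\sigma_i$ being a positive crossing), and let $\nabla_L(z)=P_L(1,z)$ be the Conway polynomial. For $p\in\mathbb Z$ let $C_p(z)$ be the Conway polynomial of the closure of the two-strand braid $\sigma_1^p\in B_2$. Let $\beta,\gamma\in B_3$ with $w(\beta)\ge w(\gamma)$. Then $P_{\widehat\beta}=P_{\widehat\gamma}$ if and only if $\nabla_{\widehat\beta}=\nabla_{\widehat\gamma}$ and at least one of the following holds: (i) $w(\beta)=w(\gamma)$; (ii) $w(\beta)=w(\gamma)+2$ and $\nabla_{\widehat\beta}=C_{w(\beta)-1}$; (iii) $w(\beta)=2$, $w(\gamma)=-2$ and $\nabla_{\widehat\beta}=1$. -/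

import Mathlib

/-- Indices of the standard generators of the braid group on `n` strands. -/
abbrev BraidGen (n : ℕ) : Type := {i : ℕ // i + 1 < n}

/-- Artin's relations. -/
inductive BraidRel (n : ℕ) : FreeGroup (BraidGen n) → Prop
  | comm (i j : BraidGen n) (h : i.1 + 1 < j.1) :
      BraidRel n (FreeGroup.of i * FreeGroup.of j * (FreeGroup.of j * FreeGroup.of i)⁻¹)
  | braid (i j : BraidGen n) (h : i.1 + 1 = j.1) :
      BraidRel n (FreeGroup.of i * FreeGroup.of j * FreeGroup.of i *
        (FreeGroup.of j * FreeGroup.of i * FreeGroup.of j)⁻¹)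

/-- Artin's braid group `B_n` on `n` strands. -/
abbrev BraidGroup (n : ℕ) : Type := PresentedGroup {r | BraidRel n r}

namespace BraidGroup

/-- The standard generator `σ_{i+1}` (generators are numbered from `0` here). -/
def σ {n : ℕ} (i : BraidGen n) : BraidGroup n := PresentedGroup.of i

theorem σ_comm {n : ℕ} (i j : BraidGen n) (h : i.1 + 1 < j.1) : σ i * σ j = σ j * σ i :=
  PresentedGroup.mk_eq_mk_of_mul_inv_mem (BraidRel.comm i j h)

theorem σ_braid {n : ℕ} (i j : BraidGen n) (h : i.1 + 1 = j.1) :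
    σ i * σ j * σ i = σ j * σ i * σ j :=
  PresentedGroup.mk_eq_mk_of_mul_inv_mem (BraidRel.braid i j h)

/-- The homomorphism from `B_n` determined by images of the generators that satisfy
Artin's relations. -/
def lift {n : ℕ} {G : Type*} [Group G] (f : BraidGen n → G)
    (hc : ∀ i j : BraidGen n, i.1 + 1 < j.1 → f i * f j = f j * f i)
    (hb : ∀ i j : BraidGen n, i.1 + 1 = j.1 → f i * f j * f i = f j * f i * f j) :
    BraidGroup n →* G :=
  PresentedGroup.toGroup (f := f) (by
    rintro r (⟨i, j, h⟩ | ⟨i, j, h⟩)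
    · rw [map_mul, map_inv, mul_inv_eq_one]; simpa using hc i j h
    · rw [map_mul, map_inv, mul_inv_eq_one]; simpa using hb i j h)

theorem lift_σ {n : ℕ} {G : Type*} [Group G] (f : BraidGen n → G)
    (hc : ∀ i j : BraidGen n, i.1 + 1 < j.1 → f i * f j = f j * f i)
    (hb : ∀ i j : BraidGen n, i.1 + 1 = j.1 → f i * f j * f i = f j * f i * f j)
    (i : BraidGen n) : lift f hc hb (σ i) = f i :=
  PresentedGroup.toGroup.of _

/-- The exponent sum, as a homomorphism: every generator is sent to `1`. -/
def writheHom (n : ℕ) : BraidGroup n →* Multiplicative ℤ :=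
  lift (fun _ => Multiplicative.ofAdd 1) (fun _ _ _ => rfl) (fun _ _ _ => rfl)

/-- The writhe (exponent sum) `w(β)` of a braid. -/
def writhe {n : ℕ} (β : BraidGroup n) : ℤ := (writheHom n β).toAdd

/-- The inclusion `B_n → B_{n+1}` that adds a trivial last strand. -/
def incl (n : ℕ) : BraidGroup n →* BraidGroup (n + 1) :=
  lift (fun i => σ ⟨i.1, Nat.lt_succ_of_lt i.2⟩) (fun _ _ h => σ_comm _ _ h)
    (fun _ _ h => σ_braid _ _ h)

/-- The last generator `σ_{n+1}` of `B_{n+2}`. -/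
def last (n : ℕ) : BraidGroup (n + 2) := σ ⟨n, Nat.lt_succ_self (n + 1)⟩

theorem incl_σ {n : ℕ} (i : BraidGen n) : incl n (σ i) = σ ⟨i.1, Nat.lt_succ_of_lt i.2⟩ :=
  lift_σ _ _ _ i

theorem writhe_σ {n : ℕ} (i : BraidGen n) : writhe (σ i) = 1 := by
  simp [writhe, writheHom, lift_σ]

theorem writhe_one {n : ℕ} : writhe (1 : BraidGroup n) = 0 := by simp [writhe]
theorem writhe_mul {n : ℕ} (a b : BraidGroup n) : writhe (a * b) = writhe a + writhe b := by
  simp [writhe]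
theorem writhe_inv {n : ℕ} (a : BraidGroup n) : writhe a⁻¹ = - writhe a := by simp [writhe]

theorem writhe_incl {n : ℕ} (a : BraidGroup n) : writhe (incl n a) = writhe a := by
  have : (writheHom (n + 1)).comp (incl n) = writheHom n := by
    refine PresentedGroup.ext fun i => ?_
    change writheHom (n + 1) (incl n (σ i)) = writheHom n (σ i)
    rw [incl_σ]; simp [writheHom, lift_σ]
  exact congrArg Multiplicative.toAdd (DFunLike.congr_fun this a)

theorem ind {n : ℕ} {p : BraidGroup n → Prop} (h1 : p 1)
    (hm : ∀ a i, p a → p (a * σ i)) (hi : ∀ a i, p a → p (a * (σ i)⁻¹)) (a : BraidGroup n) :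
    p a := by
  have ha : a ∈ Subgroup.closure (Set.range (PresentedGroup.of (rels := {r | BraidRel n r}))) := by
    rw [PresentedGroup.closure_range_of]; trivial
  induction ha using Subgroup.closure_induction_right with
  | one => exact h1
  | mul_right x y _ hy hx => obtain ⟨i, rfl⟩ := hy; exact hm _ _ hx
  | mul_inv_cancel x y _ hy hx => obtain ⟨i, rfl⟩ := hy; exact hi _ _ hx

theorem incl_comm_last {n : ℕ} (a : BraidGroup n) :
    incl (n + 1) (incl n a) * last n = last n * incl (n + 1) (incl n a) := by
  induction a using ind with
  | h1 => simp
  | hm a i h =>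
    have := σ_comm (n := n + 2) ⟨i.1, by omega⟩ ⟨n, by omega⟩ i.2
    simp only [map_mul, incl_σ, last] at h ⊢
    rw [mul_assoc, this, ← mul_assoc, h, mul_assoc]
  | hi a i h =>
    have h2 : Commute (σ (n := n + 2) ⟨i.1, by omega⟩) (σ ⟨n, by omega⟩) :=
      σ_comm (n := n + 2) ⟨i.1, by omega⟩ ⟨n, by omega⟩ i.2
    simp only [map_mul, map_inv, incl_σ, last] at h ⊢
    exact Commute.mul_left h h2.inv_left

section Span
variable {R : Type*} [CommRing R] {M : Type*} [AddCommGroup M] [Module R M]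

/-- The homogeneous skein relation for a module-valued function on a braid group. -/
def Skein (x y : R) {n : ℕ} (f : BraidGroup n → M) : Prop :=
  ∀ a i b, f (a * σ i * b) = x • f (a * b) + y • f (a * (σ i)⁻¹ * b)

theorem Skein.mul {x y : R} {n : ℕ} {f : BraidGroup n → M} (hf : Skein x y f)
    (p q : BraidGroup n) : Skein x y (fun c => f (p * c * q)) := by
  intro a i b
  simpa only [mul_assoc] using hf (p * a) i (b * q)

theorem Skein.mul_right {x y : R} {n : ℕ} {f : BraidGroup n → M} (hf : Skein x y f)
    (q : BraidGroup n) : Skein x y (fun c => f (c * q)) := by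
  simpa using hf.mul 1 q

theorem Skein.comp_incl {x y : R} {n : ℕ} {f : BraidGroup (n + 1) → M} (hf : Skein x y f) :
    Skein x y (fun c => f (incl n c)) := by
  intro a i b
  simpa only [map_mul, map_inv, incl_σ] using hf (incl n a) _ (incl n b)

theorem Skein.inv {x y : R} (hy : IsUnit y) {n : ℕ} {f : BraidGroup n → M} (hf : Skein x y f)
    {a b : BraidGroup n} {i : BraidGen n} (h1 : f (a * σ i * b) = 0) (h2 : f (a * b) = 0) :
    f (a * (σ i)⁻¹ * b) = 0 := by
  have := hf a i b
  rw [h1, h2, smul_zero, zero_add] at this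
  exact (hy.smul_eq_zero).1 this.symm

theorem braid_one (b : BraidGroup 1) : b = 1 := by
  induction b using ind with
  | h1 => rfl
  | hm a i h => exact absurd i.2 (by omega)
  | hi a i h => exact absurd i.2 (by omega)

theorem last_braid (n : ℕ) : last (n + 1) * incl (n + 2) (last n) * last (n + 1) =
    incl (n + 2) (last n) * last (n + 1) * incl (n + 2) (last n) := by
  have := σ_braid (n := n + 3) ⟨n, by omega⟩ ⟨n + 1, by omega⟩ rfl
  simp only [last, incl_σ]
  exact this.symm

theorem Skein.span_aux {x y : R} (hy : IsUnit y) (n : ℕ)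
    (key : ∀ f : BraidGroup (n + 2) → M,
      Skein x y f → (∀ a, f (incl (n + 1) a) = 0) →
      (∀ a b, f (incl (n + 1) a * last n * incl (n + 1) b) = 0) →
      ∀ a b, f (incl (n + 1) a * last n * incl (n + 1) b * last n) = 0)
    (c : BraidGroup (n + 2)) : ∀ f : BraidGroup (n + 2) → M,
      Skein x y f → (∀ a, f (incl (n + 1) a) = 0) →
      (∀ a b, f (incl (n + 1) a * last n * incl (n + 1) b) = 0) → f c = 0 := by
  have hgen : ∀ f : BraidGroup (n + 2) → M, Skein x y f → (∀ a, f (incl (n + 1) a) = 0) →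
      (∀ a b, f (incl (n + 1) a * last n * incl (n + 1) b) = 0) → ∀ i : BraidGen (n + 2),
      (∀ a, f (incl (n + 1) a * σ i) = 0) ∧
      (∀ a b, f (incl (n + 1) a * last n * incl (n + 1) b * σ i) = 0) := by
    rintro f hf h1 h2 ⟨i, hi⟩
    rcases Nat.lt_or_ge i n with h | h
    · have e : σ (n := n + 2) ⟨i, hi⟩ = incl (n + 1) (σ ⟨i, by omega⟩) :=
        (incl_σ (n := n + 1) ⟨i, by omega⟩).symm
      rw [e]
      exact ⟨fun a => by rw [← map_mul]; exact h1 _,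
        fun a b => by rw [mul_assoc, ← map_mul]; exact h2 _ _⟩
    · obtain rfl : i = n := by omega
      exact ⟨fun a => by have := h2 a 1; rw [map_one, mul_one] at this; exact this, key f hf h1 h2⟩
  induction c using ind with
  | h1 => intro f hf h1 h2; simpa using h1 1
  | hm a i h =>
    intro f hf h1 h2
    exact h (fun c => f (c * σ i)) (hf.mul_right _) (hgen f hf h1 h2 i).1 (hgen f hf h1 h2 i).2
  | hi a i h =>
    intro f hf h1 h2
    refine h (fun c => f (c * (σ i)⁻¹)) (hf.mul_right _) (fun a => ?_) (fun a b => ?_)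
    · have := hf.inv hy (a := incl (n + 1) a) (b := 1) (i := i)
      simp only [mul_one] at this
      exact this ((hgen f hf h1 h2 i).1 a) (h1 a)
    · have := hf.inv hy (a := incl (n + 1) a * last n * incl (n + 1) b) (b := 1) (i := i)
      simp only [mul_one] at this
      exact this ((hgen f hf h1 h2 i).2 a b) (h2 a b)

/-- A function on `B_{n+2}` that satisfies the skein relation is determined by its values on
`B_{n+1}` and on `B_{n+1} σ_{n+1} B_{n+1}`. -/
theorem Skein.span {x y : R} (hy : IsUnit y) : ∀ (n : ℕ) (f : BraidGroup (n + 2) → M),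
    Skein x y f → (∀ a, f (incl (n + 1) a) = 0) →
    (∀ a b, f (incl (n + 1) a * last n * incl (n + 1) b) = 0) → ∀ c, f c = 0 := by
  intro n
  induction n with
  | zero =>
    intro f hf h1 h2 c
    refine Skein.span_aux hy 0 (fun f hf h1 h2 a b => ?_) c f hf h1 h2
    have e := hf (incl 1 a * last 0) ⟨0, by omega⟩ 1
    have h3 := h2 a 1
    have h4 := h1 a
    rw [braid_one b]
    simp only [map_one, mul_one] at *
    change f (incl 1 a * last 0 * last 0) = 0
    change f (incl 1 a * last 0 * last 0) = x • f (incl 1 a * last 0) +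
      y • f (incl 1 a * last 0 * (last 0)⁻¹) at e
    rw [e, h3, mul_inv_cancel_right, h4]; simp
  | succ n ih =>
    intro f hf h1 h2 c
    refine Skein.span_aux hy (n + 1) (fun f hf h1 h2 a b => ?_) c f hf h1 h2
    have hs : Skein x y (fun b => f (incl (n + 2) a * last (n + 1) * incl (n + 2) b
      * last (n + 1))) := (hf.mul _ _).comp_incl
    refine ih _ hs (fun c => ?_) (fun c d => ?_) b
    · rw [mul_assoc, incl_comm_last c]
      have e := hf (incl (n + 2) a * last (n + 1)) ⟨n + 1, by omega⟩ (incl (n + 2) (incl (n + 1) c))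
      change f (incl (n + 2) a * last (n + 1) * last (n + 1) * _) = x • _ +
        y • f (incl (n + 2) a * last (n + 1) * (last (n + 1))⁻¹ * _) at e
      rw [mul_inv_cancel_right, h2, ← map_mul, h1] at e
      rw [← mul_assoc, e]; simp
    · have e : incl (n + 2) a * last (n + 1) * incl (n + 2) (incl (n + 1) c * last n *
          incl (n + 1) d) * last (n + 1) = incl (n + 2) (a * incl (n + 1) c * last n) *
            last (n + 1) * incl (n + 2) (last n * incl (n + 1) d) := by
        have hc := incl_comm_last c
        have hd := incl_comm_last d
        have hb := last_braid n
        simp only [map_mul]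
        calc _ = incl (n + 2) a * (last (n + 1) * incl (n + 2) (incl (n + 1) c)) *
              incl (n + 2) (last n) * (incl (n + 2) (incl (n + 1) d) * last (n + 1)) := by group
          _ = incl (n + 2) a * incl (n + 2) (incl (n + 1) c) * (last (n + 1) *
              incl (n + 2) (last n) * last (n + 1)) * incl (n + 2) (incl (n + 1) d) := by
            rw [← hc, hd]; group
          _ = _ := by rw [hb]; group
      simp only [e]
      exact h2 _ _

theorem Skein.vanish {x y : R} (hx : IsUnit x) (hy : IsUnit y)
    (f : ∀ n, BraidGroup n → M) (hs : ∀ n, Skein x y (f n))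
    (hconj : ∀ n (a b : BraidGroup n), f n (a * b) = f n (b * a))
    (hp : ∀ n (a : BraidGroup (n + 1)), f (n + 2) (incl (n + 1) a * last n) = f (n + 1) a)
    (hm : ∀ n (a : BraidGroup (n + 1)), f (n + 2) (incl (n + 1) a * (last n)⁻¹) = f (n + 1) a)
    (h1 : f 1 1 = 0) : ∀ n (a : BraidGroup (n + 1)), f (n + 1) a = 0 := by
  intro n
  induction n with
  | zero => intro a; rw [braid_one a]; exact h1
  | succ n ih =>
    refine Skein.span hy n _ (hs _) (fun a => ?_) (fun a b => ?_)
    · have e := hs (n + 2) (incl (n + 1) a) ⟨n, by omega⟩ 1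
      simp only [mul_one] at e
      change f (n + 2) (incl (n + 1) a * last n) = _ +
        y • f (n + 2) (incl (n + 1) a * (last n)⁻¹) at e
      rw [hp, hm, ih, smul_zero, add_zero] at e
      exact (hx.smul_eq_zero).1 e.symm
    · rw [hconj, ← mul_assoc, ← map_mul, hp, ih]

end Span
end BraidGroup
namespace BraidGroup
/-! The operators below only serve to prove that the Homflypt polynomial exists. -/

section Rep
variable {F : Type*} [Field F]

/-- The action of a crossing between positions `p` and `r` on functions of colourings. -/
def T {m N : ℕ} (q : F) (p r : Fin m) :
    ((Fin m → Fin N) → F) →ₗ[F] ((Fin m → Fin N) → F) where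
  toFun f c := if c p = c r then q * f c
    else if c p < c r then f (c ∘ Equiv.swap p r)
    else f (c ∘ Equiv.swap p r) + (q - q⁻¹) * f c
  map_add' f g := by
    ext c; simp only [Pi.add_apply]; split_ifs <;> ring
  map_smul' a f := by
    ext c; simp only [Pi.smul_apply, smul_eq_mul, RingHom.id_apply]; split_ifs <;> ring

theorem T_apply {m N : ℕ} (q : F) (p r : Fin m) (f : (Fin m → Fin N) → F) (c : Fin m → Fin N) :
    T q p r f c = if c p = c r then q * f c
    else if c p < c r then f (c ∘ Equiv.swap p r)
    else f (c ∘ Equiv.swap p r) + (q - q⁻¹) * f c := rfl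

theorem T_sq {m N : ℕ} {q : F} (hq : q ≠ 0) (p r : Fin m) :
    (T q p r * T q p r : Module.End F ((Fin m → Fin N) → F)) = (q - q⁻¹) • T q p r + 1 := by
  refine LinearMap.ext fun f => funext fun c => ?_
  have e : (c ∘ Equiv.swap p r) ∘ Equiv.swap p r = c := by ext x; simp
  simp only [Module.End.mul_apply, LinearMap.add_apply, LinearMap.smul_apply, Pi.add_apply,
    Pi.smul_apply, smul_eq_mul, Module.End.one_apply, T_apply, Function.comp_apply,
    Equiv.swap_apply_left, Equiv.swap_apply_right, e]
  rcases lt_trichotomy (c p) (c r) with h | h | h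
  · simp [h, h.ne, h.ne', h.not_gt]; ring
  · simp only [h, if_true]; field_simp; ring
  · simp [h, h.ne, h.ne', h.not_gt]; ring

theorem T_braid {m N : ℕ} {q : F} (hq : q ≠ 0) (p r s : Fin m) (h1 : p ≠ r) (h2 : r ≠ s)
    (h3 : p ≠ s) : (T q p r * T q r s * T q p r : Module.End F ((Fin m → Fin N) → F)) =
      T q r s * T q p r * T q r s := by
  refine LinearMap.ext fun f => funext fun c => ?_
  have e : ((c ∘ Equiv.swap p r) ∘ Equiv.swap r s) ∘ Equiv.swap p r =
      ((c ∘ Equiv.swap r s) ∘ Equiv.swap p r) ∘ Equiv.swap r s := by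
    ext x
    simp only [Function.comp_apply, Equiv.swap_apply_def]
    split_ifs <;> simp_all
  have e1 : (c ∘ Equiv.swap p r) ∘ Equiv.swap p r = c := by ext x; simp
  have e2 : (c ∘ Equiv.swap r s) ∘ Equiv.swap r s = c := by ext x; simp
  simp only [Module.End.mul_apply, T_apply, Function.comp_apply,
    Equiv.swap_apply_left, Equiv.swap_apply_right, e, e1, e2,
    Equiv.swap_apply_of_ne_of_ne h3.symm h2.symm, Equiv.swap_apply_of_ne_of_ne h1 h3]
  generalize f c = a0, f (c ∘ Equiv.swap p r) = a1, f (c ∘ Equiv.swap r s) = a2,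
    f ((c ∘ Equiv.swap p r) ∘ Equiv.swap r s) = a3,
    f ((c ∘ Equiv.swap r s) ∘ Equiv.swap p r) = a4,
    f (((c ∘ Equiv.swap r s) ∘ Equiv.swap p r) ∘ Equiv.swap r s) = a5,
    c p = x, c r = y, c s = z
  clear e e1 e2 h1 h2 h3
  have hw : q * q = (q - q⁻¹) * q + 1 := by field_simp; ring
  generalize q - q⁻¹ = w at *
  rcases lt_trichotomy x y with h | rfl | h
  · rcases lt_trichotomy y z with h' | rfl | h'
    · simp only [h, h', h.trans h', h.ne, h'.ne, (h.trans h').ne, if_true, if_false]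
    · simp only [h, h.ne, if_true, if_false]
    · rcases lt_trichotomy x z with g | rfl | g
      · simp only [h, h', g, h.ne, h'.ne', g.ne, h'.not_gt, if_true, if_false]
      · simp only [h, h.ne, h.ne', h.not_gt, if_true, if_false]; ring
      · simp only [h, h', h.ne, h.ne', h'.ne, h'.ne', g.ne', h.not_gt, h'.not_gt, g.not_gt,
          if_true, if_false]
        ring
  · rcases lt_trichotomy x z with h' | rfl | h'
    · simp only [h', h'.ne, if_true, if_false]
    · simp only [if_true]
    · simp only [h', h'.ne, h'.ne', h'.not_gt, if_true, if_false]
      linear_combination (w * a0) * hw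
  · rcases lt_trichotomy y z with h' | rfl | h'
    · rcases lt_trichotomy x z with g | rfl | g
      · simp only [h, h', g, h.ne', h'.ne, g.ne, h.not_gt, if_true, if_false]
      · simp only [h, h.ne, h.ne', h.not_gt, if_true, if_false]; ring
      · simp only [h, h', h.ne, h.ne', h'.ne, h'.ne', g.ne', h.not_gt, h'.not_gt, g.not_gt,
          if_true, if_false]
        ring
    · simp only [h, h.ne, h.ne', h.not_gt, if_true, if_false]
      linear_combination (-w * a0) * hw
    · simp only [h, h', h.ne, h'.ne, h.ne', h'.ne', (h'.trans h).ne', h.not_gt, h'.not_gt,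
        (h'.trans h).not_gt, if_true, if_false]
      ring

theorem T_comm {m N : ℕ} {q : F} (p r s t : Fin m) (h1 : p ≠ s) (h2 : p ≠ t) (h3 : r ≠ s)
    (h4 : r ≠ t) : (T q p r * T q s t : Module.End F ((Fin m → Fin N) → F)) =
      T q s t * T q p r := by
  refine LinearMap.ext fun f => funext fun c => ?_
  have e : (c ∘ Equiv.swap p r) ∘ Equiv.swap s t =
      (c ∘ Equiv.swap s t) ∘ Equiv.swap p r := by
    ext x
    simp only [Function.comp_apply, Equiv.swap_apply_def]
    split_ifs <;> simp_all
  simp only [Module.End.mul_apply, T_apply, Function.comp_apply, e,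
    Equiv.swap_apply_of_ne_of_ne h1.symm h3.symm, Equiv.swap_apply_of_ne_of_ne h2.symm h4.symm,
    Equiv.swap_apply_of_ne_of_ne h1 h2, Equiv.swap_apply_of_ne_of_ne h3 h4]
  split_ifs <;> ring
end Rep
end BraidGroup
namespace BraidGroup
section Trace
variable {F : Type*} [Field F]

/-- The action of a crossing, as an invertible operator. -/
def TUnit {m N : ℕ} {q : F} (hq : q ≠ 0) (p r : Fin m) :
    (Module.End F ((Fin m → Fin N) → F))ˣ where
  val := T q p r
  inv := T q p r - (q - q⁻¹) • 1
  val_inv := by rw [mul_sub, T_sq hq]; simp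
  inv_val := by rw [sub_mul, T_sq hq]; simp

/-- The representation of the braid group on functions of colourings. -/
def rep (n N : ℕ) {q : F} (hq : q ≠ 0) :
    BraidGroup n →* (Module.End F ((Fin n → Fin N) → F))ˣ :=
  lift (fun i => TUnit hq ⟨i.1, by omega⟩ ⟨i.1 + 1, i.2⟩)
    (fun i j h => Units.ext (T_comm _ _ _ _ (by simp; omega) (by simp; omega) (by simp; omega)
      (by simp; omega)))
    (fun ⟨i, hi⟩ ⟨j, hj⟩ h => by
      simp only at h
      subst h
      exact Units.ext (T_braid hq _ _ _ (by simp) (by simp) (by simp; omega)))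

/-- The operator of a braid. -/
def repE (n N : ℕ) {q : F} (hq : q ≠ 0) (a : BraidGroup n) :
    Module.End F ((Fin n → Fin N) → F) := (rep n N hq a).val

theorem repE_mul {n N : ℕ} {q : F} (hq : q ≠ 0) (a b : BraidGroup n) :
    repE n N hq (a * b) = repE n N hq a * repE n N hq b := by
  simp [repE]

theorem repE_one {n N : ℕ} {q : F} (hq : q ≠ 0) : repE n N hq 1 = 1 := by
  simp [repE]

theorem repE_σ {n N : ℕ} {q : F} (hq : q ≠ 0) (i : BraidGen n) :
    repE n N hq (σ i) = T q ⟨i.1, by omega⟩ ⟨i.1 + 1, i.2⟩ := by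
  rw [repE, rep, lift_σ]; rfl

theorem repE_σ_inv {n N : ℕ} {q : F} (hq : q ≠ 0) (i : BraidGen n) :
    repE n N hq (σ i)⁻¹ = repE n N hq (σ i) - (q - q⁻¹) • (1 : Module.End F _) := by
  rw [repE, repE, map_inv, rep, lift_σ]; rfl

/-- Weight of a colour. -/
def wt (N : ℕ) (q : F) (b : ℕ) : F := q ^ ((N : ℤ) - 1 - 2 * b)

/-- Multiplication by the weight of a colouring. -/
def D (n N : ℕ) (q : F) : Module.End F ((Fin n → Fin N) → F) where
  toFun f c := (∏ j, wt N q (c j)) * f c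
  map_add' f g := by ext c; simp [mul_add]
  map_smul' a f := by ext c; simp; ring

theorem D_apply {n N : ℕ} {q : F} (f : (Fin n → Fin N) → F) (c : Fin n → Fin N) :
    D n N q f c = (∏ j, wt N q (c j)) * f c := rfl

theorem D_T {n N : ℕ} {q : F} (p r : Fin n) : D n N q * T q p r = T q p r * D n N q := by
  refine LinearMap.ext fun f => funext fun c => ?_
  have : ∏ j, wt N q ((c ∘ Equiv.swap p r) j) = ∏ j, wt N q (c j) :=
    Equiv.prod_comp (Equiv.swap p r) (fun j => wt N q (c j))
  simp only [Module.End.mul_apply, D_apply, T_apply, this]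
  split_ifs <;> ring

theorem D_rep {n N : ℕ} {q : F} (hq : q ≠ 0) (a : BraidGroup n) :
    Commute (D n N q) (repE n N hq a) := by
  induction a using ind with
  | h1 => rw [repE_one]; exact Commute.one_right _
  | hm a i h =>
    rw [repE_mul]
    exact h.mul_right (by rw [repE_σ]; exact D_T _ _)
  | hi a i h =>
    rw [repE_mul, repE_σ_inv, repE_σ]
    exact h.mul_right (Commute.sub_right (D_T _ _) ((Commute.one_right _).smul_right _))

/-- Weighted trace. -/
noncomputable def tr {n N : ℕ} (q : F) (A : Module.End F ((Fin n → Fin N) → F)) : F :=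
  LinearMap.trace F _ (D n N q * A)

theorem tr_eq {n N : ℕ} (q : F) (A : Module.End F ((Fin n → Fin N) → F)) :
    tr q A = ∑ c : Fin n → Fin N, (∏ j, wt N q (c j)) * A (Pi.single c 1) c := by
  rw [tr, LinearMap.trace_eq_matrix_trace F (Pi.basisFun F (Fin n → Fin N)), Matrix.trace]
  refine Finset.sum_congr rfl fun c _ => ?_
  simp [D_apply]

theorem tr_comm {n N : ℕ} {q : F} (hq : q ≠ 0) (a b : BraidGroup n) :
    tr q (repE n N hq (a * b)) =
      tr q (repE n N hq (b * a)) := by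
  rw [tr, tr, repE_mul, repE_mul, ← mul_assoc, (D_rep hq a).eq,
    mul_assoc, LinearMap.trace_mul_comm, mul_assoc]

theorem rep_incl {n N : ℕ} {q : F} (hq : q ≠ 0) (a : BraidGroup n) :
    ∀ (f : (Fin (n + 1) → Fin N) → F) (c : Fin n → Fin N) (b : Fin N),
      (repE (n + 1) N hq (incl n a)) f
        (Fin.snoc c b : Fin (n + 1) → Fin N) =
      (repE n N hq a)
        (fun c' => f (Fin.snoc c' b : Fin (n + 1) → Fin N)) c := by
  have hg : ∀ (i : BraidGen n) (f : (Fin (n + 1) → Fin N) → F) (c : Fin n → Fin N) (b : Fin N),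
      (repE (n + 1) N hq (incl n (σ i))) f
        (Fin.snoc c b : Fin (n + 1) → Fin N) =
      (repE n N hq (σ i))
        (fun c' => f (Fin.snoc c' b : Fin (n + 1) → Fin N)) c := by
    intro i f c b
    rw [incl_σ, repE_σ, repE_σ, T_apply, T_apply]
    have h0 : (⟨i.1, by omega⟩ : Fin (n + 1)) = Fin.castSucc ⟨i.1, by omega⟩ := rfl
    have h1 : (⟨i.1 + 1, by omega⟩ : Fin (n + 1)) = Fin.castSucc ⟨i.1 + 1, i.2⟩ := rfl
    have h2 : (Fin.snoc c b : Fin (n + 1) → Fin N) ∘ Equiv.swap (Fin.castSucc ⟨i.1, by omega⟩)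
        (Fin.castSucc ⟨i.1 + 1, i.2⟩) =
        Fin.snoc (c ∘ Equiv.swap ⟨i.1, by omega⟩ ⟨i.1 + 1, i.2⟩) b := by
      funext x
      refine Fin.lastCases ?_ (fun x => ?_) x
      · rw [Function.comp_apply, Equiv.swap_apply_of_ne_of_ne (Fin.castSucc_lt_last _).ne'
          (Fin.castSucc_lt_last _).ne']
        simp
      · rw [Function.comp_apply, (Fin.castSucc_injective n).swap_apply]
        simp
    simp only [h0, h1, h2, Fin.snoc_castSucc]
  induction a using ind with
  | h1 => intro f c b; simp [repE_one]
  | hm a i h =>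
    intro f c b
    simp only [map_mul, repE_mul, Module.End.mul_apply] at *
    rw [h]
    simp only [hg]
  | hi a i h =>
    intro f c b
    simp only [map_mul, map_inv, repE_mul, Module.End.mul_apply] at *
    rw [h]
    have e : repE (n + 1) N hq (incl n (σ i))⁻¹ =
        repE (n + 1) N hq (incl n (σ i)) - (q - q⁻¹) • (1 : Module.End F _) := by
      rw [incl_σ, repE_σ_inv]
    simp only [e, repE_σ_inv, LinearMap.sub_apply, Pi.sub_apply, hg, LinearMap.smul_apply,
      Pi.smul_apply, Module.End.one_apply]
    rfl

theorem sum_snoc {n N : ℕ} (g : (Fin (n + 1) → Fin N) → F) :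
    ∑ c, g c = ∑ c : Fin n → Fin N, ∑ b : Fin N, g (Fin.snoc c b : Fin (n + 1) → Fin N) := by
  rw [← (Fin.snocEquiv (fun _ : Fin (n + 1) => Fin N)).sum_comp, Fintype.sum_prod_type,
    Finset.sum_comm]
  rfl

theorem prod_snoc {n N : ℕ} (q : F) (c : Fin n → Fin N) (b : Fin N) :
    ∏ j, wt N q ((Fin.snoc c b : Fin (n + 1) → Fin N) j) =
      (∏ j, wt N q (c j)) * wt N q b := by
  simp [Fin.prod_univ_castSucc]

theorem single_snoc {n N : ℕ} (c c' : Fin n → Fin N) (b b' : Fin N) :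
    (Pi.single (Fin.snoc c b : Fin (n + 1) → Fin N) (1 : F) : (Fin (n + 1) → Fin N) → F)
      (Fin.snoc c' b' : Fin (n + 1) → Fin N) =
      if b' = b then (Pi.single c (1 : F) : (Fin n → Fin N) → F) c' else 0 := by
  simp only [Pi.single_apply, Fin.snoc_injective2.eq_iff]
  split_ifs <;> simp_all

theorem tr_incl {n N : ℕ} {q : F} (hq : q ≠ 0) (a : BraidGroup n) :
    tr q (repE (n + 1) N hq (incl n a)) =
      (∑ b : Fin N, wt N q b) * tr q (repE n N hq a) := by
  rw [tr_eq, tr_eq, sum_snoc, Finset.mul_sum]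
  refine Finset.sum_congr rfl fun c _ => ?_
  rw [Finset.sum_mul]
  refine Finset.sum_congr rfl fun b _ => ?_
  rw [prod_snoc, rep_incl]
  simp only [single_snoc, if_true]
  ring

/-- Partial trace of a crossing. -/
def kap (q : F) (a b : ℕ) : F := if a = b then q else if a < b then 0 else q - q⁻¹

theorem sum_kap {N : ℕ} {q : F} (hq : q ≠ 0) (a : Fin N) :
    ∑ b : Fin N, wt N q b * kap q a b = q ^ (N : ℤ) := by
  have key : ∀ M : ℕ, ∑ b ∈ Finset.range M, wt N q b * kap q a b =
      if (a : ℕ) < M then q ^ (N : ℤ) else q ^ (N : ℤ) - q ^ ((N : ℤ) - 2 * M) := by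
    intro M
    induction M with
    | zero => simp
    | succ M ih =>
      rw [Finset.sum_range_succ, ih]
      have e1 : q ^ ((N : ℤ) - 1 - 2 * M) = q ^ ((N : ℤ) - 2 * M) * q⁻¹ := by
        rw [← zpow_sub_one₀ hq]; congr 1; ring
      have e2 : q ^ ((N : ℤ) - 2 * (M + 1 : ℕ)) = q ^ ((N : ℤ) - 2 * M) * q⁻¹ * q⁻¹ := by
        rw [← zpow_sub_one₀ hq, ← zpow_sub_one₀ hq]; congr 1; push_cast; ring
      rcases lt_trichotomy (a : ℕ) M with h | h | h
      · simp [kap, h, h.ne, Nat.lt_succ_of_lt h]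
      · simp [kap, h, wt, e1]; field_simp; simp
      · simp only [kap, h.ne', h.not_gt, if_false, wt, e1, e2, Nat.lt_succ_iff.not.2 h.not_ge]
        field_simp
        ring
  have := key N
  rw [if_pos a.2] at this
  rw [← this, Finset.sum_range]

theorem sum_wt {N : ℕ} {q : F} (hq : q ≠ 0) :
    (q - q⁻¹) * ∑ b : Fin N, wt N q b = q ^ (N : ℤ) - q ^ (-(N : ℤ)) := by
  have key : ∀ M : ℕ, (q - q⁻¹) * ∑ b ∈ Finset.range M, wt N q b =
      q ^ (N : ℤ) - q ^ ((N : ℤ) - 2 * M) := by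
    intro M
    induction M with
    | zero => simp
    | succ M ih =>
      rw [Finset.sum_range_succ, mul_add, ih]
      have e1 : q ^ ((N : ℤ) - 1 - 2 * M) = q ^ ((N : ℤ) - 2 * M) * q⁻¹ := by
        rw [← zpow_sub_one₀ hq]; congr 1; ring
      have e2 : q ^ ((N : ℤ) - 2 * (M + 1 : ℕ)) = q ^ ((N : ℤ) - 2 * M) * q⁻¹ * q⁻¹ := by
        rw [← zpow_sub_one₀ hq, ← zpow_sub_one₀ hq]; congr 1; push_cast; ring
      rw [wt, e1, e2]; field_simp; ring
  have := key N
  rw [Finset.sum_range] at this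
  rw [this]; congr 2; ring

theorem tr_last {n N : ℕ} {q : F} (hq : q ≠ 0) (a : BraidGroup (n + 1)) :
    tr q (repE (n + 2) N hq (incl (n + 1) a * last n)) =
      q ^ (N : ℤ) *
        tr q (repE (n + 1) N hq a) := by
  rw [tr_eq, tr_eq, sum_snoc, Finset.mul_sum]
  refine Finset.sum_congr rfl fun c _ => ?_
  rw [← sum_kap hq (c (Fin.last n)), Finset.sum_mul]
  refine Finset.sum_congr rfl fun b _ => ?_
  rw [prod_snoc, repE_mul, Module.End.mul_apply, rep_incl]
  have e : (fun c' : Fin (n + 1) → Fin N =>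
      (repE (n + 2) N hq (last n))
        (Pi.single (Fin.snoc c b : Fin (n + 2) → Fin N) 1)
        (Fin.snoc c' b : Fin (n + 2) → Fin N)) =
      kap q (c (Fin.last n)) b • (Pi.single c 1 : (Fin (n + 1) → Fin N) → F) := by
    funext c'
    rw [last, repE_σ, T_apply]
    have h0 : (⟨n, by omega⟩ : Fin (n + 2)) = Fin.castSucc (Fin.last n) := rfl
    have h1 : (⟨n + 1, by omega⟩ : Fin (n + 2)) = Fin.last (n + 1) := rfl
    simp only [h0, h1, Fin.snoc_castSucc, Fin.snoc_last, single_snoc, if_true, Pi.smul_apply,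
      smul_eq_mul]
    have h2 : c' (Fin.last n) ≠ b → (Pi.single (Fin.snoc c b : Fin (n + 2) → Fin N) (1 : F) :
        (Fin (n + 2) → Fin N) → F) ((Fin.snoc c' b : Fin (n + 2) → Fin N) ∘
          Equiv.swap (Fin.castSucc (Fin.last n)) (Fin.last (n + 1))) = 0 := by
      intro h
      refine Pi.single_eq_of_ne (fun h' => h ?_) _
      have := congrFun h' (Fin.last (n + 1))
      simpa using this
    by_cases hc : c' = c
    · subst hc
      simp only [Pi.single_eq_same, kap, Fin.val_inj, Fin.val_fin_lt]
      split_ifs with h h'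
      · ring
      · rw [h2 h]; ring
      · rw [h2 h]; ring
    · rw [Pi.single_eq_of_ne hc]
      split_ifs with h h'
      · ring
      · rw [h2 h]; ring
      · rw [h2 h]; ring
  rw [e, map_smul, Pi.smul_apply, smul_eq_mul]
  ring

end Trace
end BraidGroup
/-- The ring `ℤ[z, z⁻¹][v, v⁻¹]` of Laurent polynomials in `v` and `z`. -/
abbrev LaurentVZ : Type := LaurentPolynomial (LaurentPolynomial ℤ)

/-- The variable `v`. -/
noncomputable def LaurentVZ.v : LaurentVZ := LaurentPolynomial.T 1

/-- The variable `z`. -/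
noncomputable def LaurentVZ.z : LaurentVZ := LaurentPolynomial.C (LaurentPolynomial.T 1)

/-- The substitution `v = 1`. -/
noncomputable def LaurentVZ.atOne : LaurentVZ →+* LaurentPolynomial ℤ :=
  LaurentPolynomial.eval₂ (RingHom.id (LaurentPolynomial ℤ)) 1

namespace BraidGroup

open LaurentVZ in
/-- `P` assigns to every braid `β`, on any number of strands, the Homflypt polynomial of
the oriented link `β̂` that is the closure of `β`.  Invariance under conjugation and under both
stabilizations says, by the theorems of Alexander and Markov, that `P` is an invariant of the
oriented link `β̂`.  The closures of `a σᵢ b`, `a b`, `a σᵢ⁻¹ b` are a triple `D₊`, `D₀`, `D₋`, and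
the skein relation is `P(D₊) = v z P(D₀) + v² P(D₋)`.  The closure of `1 ∈ B_1` is the unknot.
The value on the empty braid (zero strands) is irrelevant. -/
structure IsHomflypt (P : ∀ n, BraidGroup n → LaurentVZ) : Prop where
  unknot : P 1 1 = 1
  skein : ∀ (n : ℕ) (a : BraidGroup n) (i : BraidGen n) (b : BraidGroup n),
    P n (a * σ i * b) = v * z * P n (a * b) + v ^ 2 * P n (a * (σ i)⁻¹ * b)
  conj : ∀ (n : ℕ) (a b : BraidGroup n), P n (a * b * a⁻¹) = P n b
  stab_pos : ∀ (n : ℕ) (a : BraidGroup (n + 1)),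
    P (n + 2) (incl (n + 1) a * last n) = P (n + 1) a
  stab_neg : ∀ (n : ℕ) (a : BraidGroup (n + 1)),
    P (n + 2) (incl (n + 1) a * (last n)⁻¹) = P (n + 1) a

theorem isUnit_vz : IsUnit (LaurentVZ.v * LaurentVZ.z) :=
  (LaurentPolynomial.isUnit_T 1).mul ((LaurentPolynomial.isUnit_T 1).map _)

theorem isUnit_v2 : IsUnit (LaurentVZ.v ^ 2) := (LaurentPolynomial.isUnit_T 1).pow 2

/-- There is at most one Homflypt polynomial (on braids with at least one strand). -/
theorem IsHomflypt.unique {P Q : ∀ n, BraidGroup n → LaurentVZ} (hP : IsHomflypt P)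
    (hQ : IsHomflypt Q) (n : ℕ) (a : BraidGroup (n + 1)) : P (n + 1) a = Q (n + 1) a := by
  have h := Skein.vanish (R := LaurentVZ) (M := LaurentVZ) isUnit_vz isUnit_v2
    (fun n a => P n a - Q n a)
    (fun n a i b => by simp only [hP.skein, hQ.skein, smul_eq_mul]; ring)
    (fun n a b => by
      rw [← hP.conj n b (a * b), ← hQ.conj n b (a * b)]
      simp only [mul_assoc, mul_inv_cancel, mul_one])
    (fun n a => by rw [hP.stab_pos, hQ.stab_pos])
    (fun n a => by rw [hP.stab_neg, hQ.stab_neg])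
    (by rw [hP.unknot, hQ.unknot, sub_self]) n a
  exact sub_eq_zero.1 h

section Exists

theorem laurent_map_eq_zero {A K : Type*} [CommRing A] [Field K] (ψ : A →+* K)
    {f : LaurentPolynomial A} {n : ℕ} {g : Polynomial A}
    (hg : Polynomial.toLaurent g = f * LaurentPolynomial.T n) (s : Set Kˣ)
    (hs : s.Infinite) (h : ∀ x ∈ s, LaurentPolynomial.eval₂ ψ x f = 0) : g.map ψ = 0 := by
  refine Polynomial.eq_zero_of_infinite_isRoot (g.map ψ)
    ((hs.image (Units.val_injective.injOn)).mono ?_)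
  rintro _ ⟨x, hx, rfl⟩
  have e := congrArg (LaurentPolynomial.eval₂ ψ x) hg
  rw [map_mul, h x hx, zero_mul, LaurentPolynomial.eval₂_toLaurent] at e
  change Polynomial.eval _ _ = 0
  rw [Polynomial.eval_map]
  exact e

theorem laurent_eq_zero {A : Type*} [CommRing A] {f : LaurentPolynomial A} {n : ℕ}
    {g : Polynomial A} (hg : Polynomial.toLaurent g = f * LaurentPolynomial.T n)
    (h : g = 0) : f = 0 := by
  rw [h, map_zero] at hg
  exact ((LaurentPolynomial.isUnit_T (R := A) (n : ℤ)).mul_left_eq_zero).1 hg.symm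

/-- The sample points: a number of colours and a value of `q`. -/
abbrev Pt : Type := {p : ℕ × ℝ // 1 ≤ p.1 ∧ 1 < p.2}

theorem Pt.q_ne (p : Pt) : p.1.2 ≠ 0 := by have := p.2.2; intro h; linarith

theorem Pt.z_ne (p : Pt) : p.1.2 - p.1.2⁻¹ ≠ 0 := by
  have := inv_lt_one_of_one_lt₀ p.2.2
  have := p.2.2
  intro h; linarith

/-- Evaluation at a sample point: `z = q - q⁻¹`, `v = q^(-N)`. -/
noncomputable def ev (p : Pt) : LaurentVZ →+* ℝ :=
  LaurentPolynomial.eval₂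
    (LaurentPolynomial.eval₂ (Int.castRingHom ℝ) (Units.mk0 _ p.z_ne))
    (Units.mk0 _ p.q_ne ^ (-(p.1.1 : ℤ)))

theorem ev_v (p : Pt) : ev p LaurentVZ.v = p.1.2 ^ (-(p.1.1 : ℤ)) := by
  simp [ev, LaurentVZ.v, -zpow_neg]

theorem ev_z (p : Pt) : ev p LaurentVZ.z = p.1.2 - p.1.2⁻¹ := by
  simp [ev, LaurentVZ.z]

/-- The joint evaluation. -/
noncomputable def evAll : LaurentVZ →+* (Pt → ℝ) := RingHom.pi ev

theorem evAll_injective : Function.Injective evAll := by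
  rw [injective_iff_map_eq_zero]
  intro f hf
  obtain ⟨n, g, hg⟩ := f.exists_T_pow
  refine laurent_eq_zero hg (Polynomial.ext fun k => ?_)
  obtain ⟨m, g', hg'⟩ := (g.coeff k).exists_T_pow
  rw [Polynomial.coeff_zero]
  refine laurent_eq_zero hg' ?_
  have hz : ∀ q : {q : ℝ // 1 < q}, q.1 - q.1⁻¹ ≠ 0 := fun q => Pt.z_ne ⟨(1, q.1), le_rfl, q.2⟩
  have key : ∀ q : {q : ℝ // 1 < q}, LaurentPolynomial.eval₂ (Int.castRingHom ℝ)
      (Units.mk0 _ (hz q)) (g.coeff k) = 0 := by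
    intro q
    have hq : q.1 ≠ 0 := by have := q.2; intro h; linarith
    have := laurent_map_eq_zero
      (LaurentPolynomial.eval₂ (Int.castRingHom ℝ) (Units.mk0 _ (hz q))) hg
      (Set.range fun N : ℕ => Units.mk0 q.1 hq ^ (-((N + 1 : ℕ) : ℤ)))
      (Set.infinite_range_of_injective fun N M h => by
        have h' := congrArg Units.val h
        simp only [Units.val_zpow_eq_zpow_val, Units.val_mk0] at h'
        have := zpow_right_injective₀ (by linarith [q.2]) q.2.ne' h'
        omega)
      (by
        rintro _ ⟨N, rfl⟩
        exact congrFun hf ⟨(N + 1, q.1), by simp, q.2⟩)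
    have h2 := congrArg (fun p => Polynomial.coeff p k) this
    simpa using h2
  have := laurent_map_eq_zero (Int.castRingHom ℝ) hg'
    (Set.range fun q : {q : ℝ // 1 < q} => Units.mk0 _ (hz q))
    (by
      have : Infinite {q : ℝ // 1 < q} := (Set.Ioi_infinite (1 : ℝ)).to_subtype
      refine Set.infinite_range_of_injective fun q r h => Subtype.ext ?_
      have h' : q.1 - q.1⁻¹ = r.1 - r.1⁻¹ := congrArg Units.val h
      have hq := q.2
      have hr := r.2
      have hq0 : q.1 ≠ 0 := by linarith
      have hr0 : r.1 ≠ 0 := by linarith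
      have h3 : (q.1 - r.1) * (q.1 * r.1 + 1) = 0 := by
        field_simp at h'
        linear_combination h'
      rcases mul_eq_zero.1 h3 with h3 | h3
      · linarith
      · nlinarith)
    (by rintro _ ⟨q, rfl⟩; exact key q)
  exact (Polynomial.map_eq_zero_iff (RingHom.injective_int _)).1 this

/-- The invariant at a sample point. -/
noncomputable def phi (n : ℕ) (a : BraidGroup n) (p : Pt) : ℝ :=
  (ev p LaurentVZ.v) ^ (writhe a) * tr p.1.2 (repE n p.1.1 p.q_ne a) /
    ∑ b : Fin p.1.1, wt p.1.1 p.1.2 b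

theorem phi_den (p : Pt) : ∑ b : Fin p.1.1, wt p.1.1 p.1.2 b ≠ 0 := by
  have hq : 0 < p.1.2 := by have := p.2.2; linarith
  have hN : 0 < p.1.1 := p.2.1
  refine ne_of_gt (Finset.sum_pos (fun b _ => zpow_pos hq _) ⟨⟨0, hN⟩, Finset.mem_univ _⟩)

theorem phi_unknot (p : Pt) : phi 1 1 p = 1 := by
  have : tr p.1.2 (repE 1 p.1.1 p.q_ne 1) = ∑ b : Fin p.1.1, wt p.1.1 p.1.2 b := by
    rw [tr_eq, repE_one]
    simp only [Module.End.one_apply, Pi.single_eq_same, mul_one, Fin.prod_univ_one]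
    exact (Equiv.funUnique (Fin 1) (Fin p.1.1)).sum_comp (fun b => wt p.1.1 p.1.2 b)
  rw [phi, this, writhe_one, zpow_zero, one_mul, div_self (phi_den p)]

theorem ev_v_ne (p : Pt) : ev p LaurentVZ.v ≠ 0 := by
  rw [ev_v]; exact zpow_ne_zero _ p.q_ne

theorem tr_sub_smul {n N : ℕ} (q s : ℝ) (A B : Module.End ℝ ((Fin n → Fin N) → ℝ)) :
    tr q (A - s • B) = tr q A - s * tr q B := by
  simp [tr, mul_sub]

theorem tr_σ_inv {n : ℕ} (a : BraidGroup n) (i : BraidGen n) (b : BraidGroup n) (p : Pt) :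
    tr p.1.2 (repE n p.1.1 p.q_ne (a * (σ i)⁻¹ * b)) =
      tr p.1.2 (repE n p.1.1 p.q_ne (a * σ i * b)) -
      (p.1.2 - p.1.2⁻¹) * tr p.1.2 (repE n p.1.1 p.q_ne (a * b)) := by
  rw [← tr_sub_smul]
  congr 1
  simp only [repE_mul, repE_σ_inv, mul_sub, sub_mul]
  simp

theorem phi_skein (n : ℕ) (a : BraidGroup n) (i : BraidGen n) (b : BraidGroup n) (p : Pt) :
    phi n (a * σ i * b) p = ev p (LaurentVZ.v * LaurentVZ.z) * phi n (a * b) p +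
      ev p (LaurentVZ.v ^ 2) * phi n (a * (σ i)⁻¹ * b) p := by
  simp only [phi, tr_σ_inv, map_mul, map_pow, ev_z]
  have h1 : writhe (a * σ i * b) = writhe (a * b) + 1 := by
    simp only [writhe_mul, writhe_σ]; ring
  have h2 : writhe (a * b) = writhe (a * (σ i)⁻¹ * b) + 1 := by
    simp only [writhe_mul, writhe_inv, writhe_σ]; ring
  rw [h1, h2, zpow_add_one₀ (ev_v_ne p), zpow_add_one₀ (ev_v_ne p)]
  ring

theorem phi_comm (n : ℕ) (a b : BraidGroup n) : phi n (a * b) = phi n (b * a) := by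
  funext p
  simp only [phi, tr_comm p.q_ne a b, writhe_mul, add_comm]

theorem phi_pos (n : ℕ) (a : BraidGroup (n + 1)) (p : Pt) :
    phi (n + 2) (incl (n + 1) a * last n) p = phi (n + 1) a p := by
  have h1 : writhe (incl (n + 1) a * last n) = writhe a + 1 := by
    rw [writhe_mul, writhe_incl, last, writhe_σ]
  have h2 : ev p LaurentVZ.v * p.1.2 ^ (p.1.1 : ℤ) = 1 := by
    rw [ev_v, ← zpow_add₀ p.q_ne]; simp
  rw [phi, phi, tr_last, h1, zpow_add_one₀ (ev_v_ne p)]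
  linear_combination (ev p LaurentVZ.v ^ writhe a * tr p.1.2 (repE (n + 1) p.1.1 p.q_ne a) /
    ∑ b : Fin p.1.1, wt p.1.1 p.1.2 b) * h2

theorem phi_neg (n : ℕ) (a : BraidGroup (n + 1)) (p : Pt) :
    phi (n + 2) (incl (n + 1) a * (last n)⁻¹) p = phi (n + 1) a p := by
  have h1 : writhe a = writhe (incl (n + 1) a * (last n)⁻¹) + 1 := by
    rw [writhe_mul, writhe_inv, writhe_incl, last, writhe_σ]; ring
  have h2 := tr_σ_inv (incl (n + 1) a) ⟨n, by omega⟩ 1 p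
  rw [mul_one, mul_one, mul_one] at h2
  change tr _ (repE (n + 2) _ _ (incl (n + 1) a * (last n)⁻¹)) =
    tr _ (repE (n + 2) _ _ (incl (n + 1) a * last n)) - _ at h2
  rw [tr_last, tr_incl, ← mul_assoc, sum_wt p.q_ne, ← ev_v] at h2
  rw [phi, phi, h2, h1, zpow_add_one₀ (ev_v_ne p)]
  ring

theorem phi_mem (n : ℕ) (a : BraidGroup (n + 1)) : ∃ r, evAll r = phi (n + 1) a := by
  let _ : Module LaurentVZ (Pt → ℝ) := Module.compHom _ evAll
  have hsmul : ∀ (r : LaurentVZ) (x : Pt → ℝ), r • x = evAll r * x := fun _ _ => rfl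
  let S : Submodule LaurentVZ (Pt → ℝ) :=
    LinearMap.range (LinearMap.toSpanSingleton LaurentVZ (Pt → ℝ) 1)
  have h := Skein.vanish (R := LaurentVZ) (M := (Pt → ℝ) ⧸ S) isUnit_vz isUnit_v2
    (fun n a => S.mkQ (phi n a))
    (fun n a i b => by
      rw [← map_smul, ← map_smul, ← map_add]
      exact congrArg S.mkQ (funext fun p => phi_skein n a i b p))
    (fun n a b => by rw [phi_comm])
    (fun n a => congrArg S.mkQ (funext fun p => phi_pos n a p))
    (fun n a => congrArg S.mkQ (funext fun p => phi_neg n a p))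
    (by
      rw [Submodule.mkQ_apply, Submodule.Quotient.mk_eq_zero]
      exact ⟨1, by funext p; simp [phi_unknot]⟩) n a
  rw [Submodule.mkQ_apply, Submodule.Quotient.mk_eq_zero] at h
  obtain ⟨r, hr⟩ := h
  exact ⟨r, by simpa [hsmul] using hr⟩

end Exists

theorem exists_isHomflypt : ∃ P, IsHomflypt P := by
  have hinv : ∀ n (a : BraidGroup (n + 1)),
      evAll (Function.invFun evAll (phi (n + 1) a)) = phi (n + 1) a :=
    fun n a => Function.invFun_eq (phi_mem n a)
  refine ⟨fun n a => Function.invFun evAll (phi n a), ?_, ?_, ?_, ?_, ?_⟩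
  · refine evAll_injective ?_
    rw [hinv 0, map_one]
    funext p; exact phi_unknot p
  · intro n a i b
    obtain ⟨m, rfl⟩ : ∃ m, n = m + 1 := ⟨n - 1, by have := i.2; omega⟩
    refine evAll_injective ?_
    rw [map_add, map_mul evAll (LaurentVZ.v * LaurentVZ.z), map_mul evAll (LaurentVZ.v ^ 2),
      hinv, hinv, hinv]
    funext p; exact phi_skein _ a i b p
  · intro n a b
    simp only [phi_comm n (a * b) a⁻¹, inv_mul_cancel_left]
  · intro n a
    have : phi (n + 2) (incl (n + 1) a * last n) = phi (n + 1) a := funext (phi_pos n a)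
    simp only [this]
  · intro n a
    have : phi (n + 2) (incl (n + 1) a * (last n)⁻¹) = phi (n + 1) a := funext (phi_neg n a)
    simp only [this]

/-- The Homflypt polynomial `P_{β̂}(v, z)` of the closure of a braid `β` (on at least one strand);
it exists by `exists_isHomflypt` and is unique by `IsHomflypt.unique`. -/
noncomputable def homflypt {n : ℕ} (β : BraidGroup n) : LaurentVZ :=
  exists_isHomflypt.choose n β

/-- The characterization of the Homflypt polynomial. -/
theorem isHomflypt_homflypt : IsHomflypt (fun _ β => homflypt β) :=
  exists_isHomflypt.choose_spec

/-- The Conway polynomial `∇_{β̂}(z) = P_{β̂}(1, z)` of the closure of a braid `β`. -/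
noncomputable def conway {n : ℕ} (β : BraidGroup n) : LaurentPolynomial ℤ :=
  LaurentVZ.atOne (homflypt β)

/-- The Conway polynomial `C_p` of the elementary torus link `T_p`, the closure of
`σ₁ ^ p ∈ B_2`, for an integer `p`. -/
noncomputable def torusConway (p : ℤ) : LaurentPolynomial ℤ :=
  conway ((last 0) ^ p)

end BraidGroup

namespace BraidGroup
open LaurentPolynomial (C)

/-! For closed 3-braids, the writhe `w` and the Conway polynomial `N` together determine `P` through
an explicit formula: `z² P = (C_{w+1} - N) v^{w-2} + ((z² + 2) N - C_{w+1} - C_{w-1}) v^w + (C_{w-1}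
- N) v^{w+2}` (`homflypt_threeBraid`). Both sides obey the same skein relation
(`threeBraidPoly_skein`, which rests on `C_{p+1} = z C_p + C_{p-1}`) and are invariant under
conjugation. By `Skein.span`, applied to `B_3` and then to `B_2`, such functions are determined by
their values on `1`, `σ₁`, `σ₂` and `σ₁σ₂`, where the formula is checked by hand.

Since `z` is invertible, the theorem becomes a comparison of two such three-term polynomials in `v`.
Equality of `P` forces equality of `N`, by setting `v = 1`. Given a common `N` and `w > w'`, the top
term of the first and the bottom term of the second meet nothing on the other side, so `N = C_{w-1}
= C_{w'+1}`. If `w - w' = 2` these are one condition. If `w - w' = 4`, they give `z C_{w'+2} = 0`,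
which forces `w' = -2` and `N = 1`, because `C_p` vanishes only for `p = 0` (`torusConway_ne_zero`).
For any other gap the supports are disjoint, which is impossible because the polynomial is never
zero (`threeBraidPoly_ne_zero`). -/

/-! ### Skein relations, conjugation and stabilization for `P` and `∇`. -/

theorem homflypt_skein {n : ℕ} (a : BraidGroup n) (i : BraidGen n) (b : BraidGroup n) :
    homflypt (a * σ i * b) = LaurentVZ.v * LaurentVZ.z * homflypt (a * b) +
      LaurentVZ.v ^ 2 * homflypt (a * (σ i)⁻¹ * b) :=
  isHomflypt_homflypt.skein n a i b

theorem homflypt_mul_comm {n : ℕ} (a b : BraidGroup n) : homflypt (a * b) = homflypt (b * a) := by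
  have h := isHomflypt_homflypt.conj n b (a * b)
  simpa only [← mul_assoc, mul_inv_cancel_right] using h.symm

theorem atOne_v : LaurentVZ.atOne LaurentVZ.v = 1 := by
  simp [LaurentVZ.atOne, LaurentVZ.v]

theorem atOne_z : LaurentVZ.atOne LaurentVZ.z = LaurentPolynomial.T 1 := by
  simp [LaurentVZ.atOne, LaurentVZ.z]

theorem conway_skein {n : ℕ} (a : BraidGroup n) (i : BraidGen n) (b : BraidGroup n) :
    conway (a * σ i * b) = LaurentPolynomial.T 1 * conway (a * b) + conway (a * (σ i)⁻¹ * b) := by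
  simp only [conway, homflypt_skein, map_add, map_mul, map_pow, atOne_v, atOne_z, one_mul, one_pow]

theorem conway_mul_comm {n : ℕ} (a b : BraidGroup n) : conway (a * b) = conway (b * a) := by
  rw [conway, homflypt_mul_comm, conway]

theorem homflypt_stab (n : ℕ) (a : BraidGroup (n + 1)) :
    homflypt (incl (n + 1) a * last n) = homflypt a :=
  isHomflypt_homflypt.stab_pos n a

/-- Adding a trivial strand gives the split union with an unknot. Both stabilizations of `a` have
the polynomial of `a`, so the skein relation at the new crossing leaves only the smoothed term to
solve for. -/
theorem homflypt_incl (n : ℕ) (a : BraidGroup (n + 1)) :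
    LaurentVZ.v * LaurentVZ.z * homflypt (incl (n + 1) a) =
      (1 - LaurentVZ.v ^ 2) * homflypt a := by
  have e := homflypt_skein (incl (n + 1) a) ⟨n, by omega⟩ 1
  simp only [mul_one] at e
  have hp := isHomflypt_homflypt.stab_pos n a
  have hm := isHomflypt_homflypt.stab_neg n a
  rw [last] at hp hm
  rw [hp, hm] at e
  linear_combination -e

/-- The factor `1 - v²` of the split union dies at `v = 1`, while `z` stays invertible. -/
theorem conway_incl (n : ℕ) (a : BraidGroup (n + 1)) : conway (incl (n + 1) a) = 0 := by
  have h := congrArg LaurentVZ.atOne (homflypt_incl n a)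
  simp only [map_mul, map_sub, map_pow, map_one, atOne_v, atOne_z, one_mul, one_pow, sub_self,
    zero_mul] at h
  exact ((LaurentPolynomial.isUnit_T 1).mul_right_eq_zero).1 h

theorem homflypt_unknot : homflypt (1 : BraidGroup 1) = 1 := isHomflypt_homflypt.unknot

theorem homflypt_last_zero : homflypt (last 0) = 1 := by
  simpa [homflypt_unknot] using homflypt_stab 0 1

/-! ### The Fibonacci-type sequence `C_p`. -/

theorem torusConway_zero : torusConway 0 = 0 := by
  simpa [torusConway] using conway_incl 0 1

theorem torusConway_one : torusConway 1 = 1 := by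
  simp [torusConway, conway, homflypt_last_zero]

theorem torusConway_add_one (p : ℤ) :
    torusConway (p + 1) = LaurentPolynomial.T 1 * torusConway p + torusConway (p - 1) := by
  have h := conway_skein (last 0 ^ p) ⟨0, by omega⟩ 1
  simp only [mul_one] at h
  rw [torusConway, torusConway, torusConway, zpow_add_one, zpow_sub_one]
  exact h

theorem torusConway_neg_one : torusConway (-1) = 1 := by
  have h := torusConway_add_one 0
  simpa [torusConway_zero, torusConway_one] using h.symm

theorem torusConway_two : torusConway 2 = LaurentPolynomial.T 1 := by
  have h := torusConway_add_one 1
  norm_num [torusConway_zero, torusConway_one] at h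
  exact h

theorem torusConway_three : torusConway 3 = LaurentPolynomial.T 1 ^ 2 + 1 := by
  have h := torusConway_add_one 2
  norm_num [torusConway_two, torusConway_one] at h
  rw [h, sq]

/-- At `z = 1` the recursion becomes that of the Fibonacci numbers, which vanish only at index `0`,
also when continued to negative indices. -/
theorem torusConway_ne_zero {p : ℤ} (hp : p ≠ 0) : torusConway p ≠ 0 := by
  let g : LaurentPolynomial ℤ →+* ℤ := LaurentPolynomial.eval₂ (RingHom.id ℤ) 1
  have hrec : ∀ p, g (torusConway (p + 1)) = g (torusConway p) + g (torusConway (p - 1)) := by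
    intro p
    rw [torusConway_add_one]
    simp [g]
  have h0 : g (torusConway 0) = 0 := by rw [torusConway_zero, map_zero]
  have h1 : g (torusConway 1) = 1 := by rw [torusConway_one, map_one]
  have hpos : ∀ n : ℕ, 0 ≤ g (torusConway n) ∧ 0 < g (torusConway (n + 1)) := by
    intro n
    induction n with
    | zero => simp [h0, h1]
    | succ n ih =>
      have := hrec (n + 1)
      rw [add_sub_cancel_right] at this
      push_cast
      omega
  -- At negative indices the signs alternate: the value at `-n` is `(-1)^(n+1)` times the `n`-th
  -- Fibonacci number.
  have hneg : ∀ n : ℕ, 0 ≤ (-1) ^ n * g (torusConway (-n)) * (-1) ∧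
      0 < (-1) ^ n * g (torusConway (-(n + 1))) := by
    intro n
    induction n with
    | zero => simp [h0, torusConway_neg_one]
    | succ n ih =>
      have := hrec (-(n + 1))
      rw [show -((n : ℤ) + 1) + 1 = -n by ring,
        show -((n : ℤ) + 1) - 1 = -(n + 1 + 1) by ring] at this
      rw [this] at ih
      push_cast
      rw [pow_succ]
      constructor <;> linarith
  intro h
  have hg : g (torusConway p) = 0 := by rw [h, map_zero]
  obtain ⟨n, rfl | rfl⟩ : ∃ n : ℕ, p = n + 1 ∨ p = -(n + 1) := by
    refine ⟨p.natAbs - 1, ?_⟩; omega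
  · exact (hpos n).2.ne' hg
  · have := (hneg n).2
    rw [hg, mul_zero] at this
    exact lt_irrefl _ this

theorem torusConway_eq_zero_iff {p : ℤ} : torusConway p = 0 ↔ p = 0 :=
  ⟨fun h => by_contra fun hp => torusConway_ne_zero hp h, fun h => h ▸ torusConway_zero⟩

/-! ### The formula for `P` in terms of writhe and Conway polynomial. -/

/-- The polynomial in `v` with coefficients in `ℤ[z, z⁻¹]` that equals `z² P` for a closed
3-braid of writhe `w` with Conway polynomial `N`. -/
noncomputable def threeBraidPoly (w : ℤ) (N : LaurentPolynomial ℤ) : LaurentVZ :=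
  C (torusConway (w + 1) - N) * LaurentPolynomial.T (w - 2) +
    C ((LaurentPolynomial.T 1 ^ 2 + 2) * N - torusConway (w + 1) - torusConway (w - 1)) * LaurentPolynomial.T w +
    C (torusConway (w - 1) - N) * LaurentPolynomial.T (w + 2)

/-- The three exponents line up after multiplication by `v` and `v²`, so the relation holds term by
term in `v`. Each coefficient is linear in `N` and in the `C_p`, and these obey the Conway skein
relation. -/
theorem threeBraidPoly_skein (w : ℤ) (N₀ N₁ : LaurentPolynomial ℤ) :
    threeBraidPoly (w + 1) (LaurentPolynomial.T 1 * N₀ + N₁) =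
      LaurentVZ.v * LaurentVZ.z * threeBraidPoly w N₀ +
        LaurentVZ.v ^ 2 * threeBraidPoly (w - 1) N₁ := by
  have h1 := torusConway_add_one (w + 1)
  have h2 := torusConway_add_one (w - 1)
  rw [add_sub_cancel_right] at h1
  rw [sub_add_cancel] at h2
  -- The lowest exponent that occurs is `w - 3`. Splitting it off leaves natural powers of `v`,
  -- which `ring` can handle.
  have ht : ∀ k : ℕ, (LaurentPolynomial.T (w - 3 + k) : LaurentVZ) =
      LaurentPolynomial.T (w - 3) * LaurentVZ.v ^ k := fun k => by
    rw [LaurentPolynomial.T_add, LaurentVZ.v, LaurentPolynomial.T_pow, mul_one]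
  have e0 : w - 1 - 2 = w - 3 + (0 : ℕ) := by push_cast; ring
  have e1 : w - 2 = w - 3 + (1 : ℕ) := by push_cast; ring
  have e1' : w + 1 - 2 = w - 3 + (2 : ℕ) := by push_cast; ring
  have e2 : w - 1 = w - 3 + (2 : ℕ) := by push_cast; ring
  have e3 : w = w - 3 + (3 : ℕ) := by push_cast; ring
  have e4 : w + 1 = w - 3 + (4 : ℕ) := by push_cast; ring
  have e4' : w - 1 + 2 = w - 3 + (4 : ℕ) := by push_cast; ring
  have e5 : w + 2 = w - 3 + (5 : ℕ) := by push_cast; ring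
  have e6 : w + 1 + 2 = w - 3 + (6 : ℕ) := by push_cast; ring
  have f0 := (congrArg _ e0).trans (ht 0)
  have f1 := (congrArg _ e1).trans (ht 1)
  have f1' := (congrArg _ e1').trans (ht 2)
  have f2 := (congrArg _ e2).trans (ht 2)
  have f3 := (congrArg _ e3).trans (ht 3)
  have f4 := (congrArg _ e4).trans (ht 4)
  have f4' := (congrArg _ e4').trans (ht 4)
  have f5 := (congrArg _ e5).trans (ht 5)
  have f6 := (congrArg _ e6).trans (ht 6)
  simp only [threeBraidPoly, f0, f1, f1', f2, f3, f4, f4', f5, f6, h1, h2, add_sub_cancel_right,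
    sub_add_cancel, LaurentVZ.z, map_add, map_sub, map_mul, map_pow]
  ring

/-- The Homflypt polynomial of a closed 3-braid is determined by its writhe and its Conway
polynomial. -/
theorem homflypt_threeBraid (a : BraidGroup 3) :
    LaurentVZ.z ^ 2 * homflypt a = threeBraidPoly (writhe a) (conway a) := by
  -- The defect `f` satisfies the homogeneous skein relation and is conjugation invariant, so it
  -- suffices to kill it on a few braids.
  let f : BraidGroup 3 → LaurentVZ := fun a =>
    LaurentVZ.z ^ 2 * homflypt a - threeBraidPoly (writhe a) (conway a)
  have hf : Skein (LaurentVZ.v * LaurentVZ.z) (LaurentVZ.v ^ 2) f := by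
    intro a i b
    have h1 : writhe (a * σ i * b) = writhe (a * b) + 1 := by
      simp only [writhe_mul, writhe_σ]; ring
    have h2 : writhe (a * (σ i)⁻¹ * b) = writhe (a * b) - 1 := by
      simp only [writhe_mul, writhe_inv, writhe_σ]; ring
    simp only [f, h1, h2, homflypt_skein, conway_skein, threeBraidPoly_skein, smul_eq_mul]
    ring
  have hc : ∀ a b, f (a * b) = f (b * a) := fun a b => by
    simp only [f, homflypt_mul_comm a b, conway_mul_comm a b, writhe_mul, add_comm (writhe a)]
  have hv : ∀ k : ℤ, (LaurentPolynomial.T k : LaurentVZ) * LaurentPolynomial.T (-k) = 1 :=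
    fun k => by rw [← LaurentPolynomial.T_add]; simp
  have hv1 := hv 1
  have hv2 := hv 2
  have hT2 : (LaurentPolynomial.T 2 : LaurentVZ) = LaurentVZ.v ^ 2 := by
    rw [LaurentVZ.v, LaurentPolynomial.T_pow]; rfl
  have hT1 : (LaurentPolynomial.T 1 : LaurentVZ) = LaurentVZ.v := rfl
  have hCz : (C (LaurentPolynomial.T 1) : LaurentVZ) = LaurentVZ.z := rfl
  rw [hT1] at hv1
  rw [hT2] at hv2
  have h2 : LaurentVZ.v * LaurentVZ.z * homflypt (1 : BraidGroup 2) = 1 - LaurentVZ.v ^ 2 := by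
    simpa [homflypt_unknot] using homflypt_incl 0 1
  have h3 : LaurentVZ.v * LaurentVZ.z * homflypt (1 : BraidGroup 3) =
      (1 - LaurentVZ.v ^ 2) * homflypt (1 : BraidGroup 2) := by
    simpa using homflypt_incl 1 1
  have n2 : conway (1 : BraidGroup 2) = 0 := by simpa using conway_incl 0 1
  have n3 : conway (1 : BraidGroup 3) = 0 := by simpa using conway_incl 1 1
  have f1 : f 1 = 0 := by
    simp only [f, n3, writhe_one, threeBraidPoly, zero_add, zero_sub, torusConway_one,
      torusConway_neg_one]
    simp only [mul_zero, sub_zero, map_zero, map_one, one_mul, map_sub, LaurentPolynomial.T_zero,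
      mul_one, hT2]
    -- At `w = 0`, `N = 0` the formula reads `v⁻² - 2 + v²`. Multiplying by `v²` turns the claim
    -- into the square of the split-union relation.
    refine isUnit_v2.mul_right_eq_zero.1 ?_
    linear_combination LaurentVZ.v * LaurentVZ.z * h3 + (1 - LaurentVZ.v ^ 2) * h2 - hv2
  have f2 : f (last 1) = 0 := by
    have e1 : homflypt (last 1) = homflypt (1 : BraidGroup 2) := by
      simpa using homflypt_stab 1 1
    have e2 : conway (last 1) = 0 := by rw [conway, e1, ← conway, n2]
    have e3 : writhe (last 1) = 1 := writhe_σ _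
    simp only [f, e1, e2, e3, threeBraidPoly]
    norm_num [torusConway_zero, torusConway_two]
    rw [hT1, hCz]
    -- At `w = 1`, `N = 0` the formula reads `z v⁻¹ - z v`, so one factor `v` clears the
    -- denominator.
    refine (LaurentPolynomial.isUnit_T (R := LaurentPolynomial ℤ) 1).mul_right_eq_zero.1 ?_
    rw [hT1]
    linear_combination LaurentVZ.z * h2 - LaurentVZ.z * hv1
  have f12 : f (incl 2 (last 0) * last 1) = 0 := by
    have e1 : homflypt (incl 2 (last 0) * last 1) = 1 := by
      rw [homflypt_stab 1, homflypt_last_zero]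
    have e2 : conway (incl 2 (last 0) * last 1) = 1 := by rw [conway, e1, map_one]
    have e3 : writhe (incl 2 (last 0) * last 1) = 2 := by
      rw [writhe_mul, writhe_incl, last, last, writhe_σ, writhe_σ]; rfl
    simp only [f, e1, e2, e3, threeBraidPoly]
    norm_num [torusConway_three, torusConway_one]
    rw [← hCz, ← map_pow, LaurentPolynomial.T_pow]
    norm_num
  -- By the braid relation `σ₁σ₂` conjugates `σ₁` into `σ₂`, so this value is the one already
  -- computed.
  have f1' : f (incl 2 (last 0)) = 0 := by
    have e : incl 2 (last 0) * last 1 * incl 2 (last 0) =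
        last 1 * (incl 2 (last 0) * last 1) := by
      rw [← mul_assoc]; exact (last_braid 0).symm
    have e' := hc (incl 2 (last 0) * last 1)⁻¹ (incl 2 (last 0) * last 1 * incl 2 (last 0))
    rw [inv_mul_cancel_left, e, mul_inv_cancel_right] at e'
    rw [e', f2]
  -- One level down `B_1` is trivial, so the spanning statement for `B_2` leaves only the braids `1`
  -- and `σ₁`.
  have key : ∀ g : BraidGroup 2 → LaurentVZ, Skein (LaurentVZ.v * LaurentVZ.z) (LaurentVZ.v ^ 2) g →
      g 1 = 0 → g (last 0) = 0 → ∀ b, g b = 0 := fun g hg h1 h2 =>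
    Skein.span isUnit_v2 0 g hg (fun a => by simpa [braid_one a] using h1)
      (fun a b => by simpa [braid_one a, braid_one b] using h2)
  refine sub_eq_zero.1 (Skein.span isUnit_v2 1 f hf ?_ (fun a b => ?_) a)
  · exact key _ hf.comp_incl (by simpa using f1) f1'
  -- Conjugation brings `a σ₂ b` to `(b a) σ₂`, a skein function of `b a ∈ B_2`.
  · rw [hc, ← mul_assoc, ← map_mul]
    exact key _ (hf.mul_right (last 1)).comp_incl (by simpa using f2) f12 _

/-! ### Comparison of two three-term polynomials. -/

theorem coeff_threeBraidPoly (w : ℤ) (N : LaurentPolynomial ℤ) (k : ℤ) :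
    (threeBraidPoly w N).coeff k =
      (if k = w - 2 then torusConway (w + 1) - N else 0) +
        (if k = w then
          (LaurentPolynomial.T 1 ^ 2 + 2) * N - torusConway (w + 1) - torusConway (w - 1) else 0) +
        (if k = w + 2 then torusConway (w - 1) - N else 0) := by
  simp only [threeBraidPoly, ← LaurentPolynomial.single_eq_C_mul_T, AddMonoidAlgebra.coeff_add,
    AddMonoidAlgebra.coeff_single, Finsupp.add_apply, Finsupp.single_apply, eq_comm (b := k)]

theorem torusConway_sub_eq (w : ℤ) :
    torusConway (w + 1) - torusConway (w - 1) = LaurentPolynomial.T 1 * torusConway w := by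
  rw [torusConway_add_one, add_sub_cancel_right]

theorem eq_zero_of_torusConway_eq {w : ℤ} (h : torusConway (w + 1) = torusConway (w - 1)) :
    w = 0 := by
  have e := torusConway_sub_eq w
  rw [h, sub_self] at e
  exact torusConway_eq_zero_iff.1
    (((LaurentPolynomial.isUnit_T 1).mul_right_eq_zero).1 e.symm)

/-- Vanishing outer coefficients give `C_{w+1} = N = C_{w-1}`, hence `w = 0` and `N = 1`. The middle
coefficient is then `z²`. -/
theorem threeBraidPoly_ne_zero (w : ℤ) (N : LaurentPolynomial ℤ) : threeBraidPoly w N ≠ 0 := by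
  intro h
  have hk : ∀ k, (threeBraidPoly w N).coeff k = 0 := fun k => by rw [h]; rfl
  simp only [coeff_threeBraidPoly] at hk
  have ha := hk (w - 2)
  have hb := hk w
  have hc := hk (w + 2)
  simp at ha hb hc
  rw [if_neg (by omega)] at ha hc
  rw [add_zero, sub_eq_zero] at ha
  rw [zero_add, sub_eq_zero] at hc
  obtain rfl := eq_zero_of_torusConway_eq (ha.trans hc.symm)
  rw [← ha] at hb
  norm_num [torusConway_one, torusConway_neg_one] at hb
  refine (LaurentPolynomial.isUnit_T (R := ℤ) 2).ne_zero ?_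
  linear_combination hb

theorem threeBraidPoly_eq_iff {w w' : ℤ} (hw : w' ≤ w) (N : LaurentPolynomial ℤ) :
    threeBraidPoly w N = threeBraidPoly w' N ↔
      w = w' ∨ (w = w' + 2 ∧ N = torusConway (w - 1)) ∨ (w = 2 ∧ w' = -2 ∧ N = 1) := by
  constructor
  · intro h
    have hk : ∀ k, (threeBraidPoly w N).coeff k = (threeBraidPoly w' N).coeff k := fun k => by
      rw [h]
    simp only [coeff_threeBraidPoly] at hk
    rcases hw.eq_or_lt with rfl | hlt
    · exact Or.inl rfl
    right
    -- The exponent `w + 2` exceeds all those of the polynomial for `w'`.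
    have hc : N = torusConway (w - 1) := by
      have := hk (w + 2)
      rw [if_neg (by omega), if_neg (by omega), if_pos rfl, if_neg (by omega), if_neg (by omega),
        if_neg (by omega), zero_add, zero_add, zero_add, sub_eq_zero] at this
      exact this.symm
    by_cases h2 : w = w' + 2
    · exact Or.inl ⟨h2, hc⟩
    right
    -- Dually, `w' - 2` lies below all exponents of the polynomial for `w`.
    have ha : torusConway (w' + 1) = N := by
      have := hk (w' - 2)
      rw [if_neg (by omega), if_neg (by omega), if_neg (by omega), if_pos rfl, if_neg (by omega),
        if_neg (by omega), add_zero, add_zero, add_zero, add_zero, eq_comm, sub_eq_zero] at this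
      exact this
    by_cases h4 : w = w' + 4
    · have h0 : w' + 2 = 0 := eq_zero_of_torusConway_eq (by
        rw [show w' + 2 + 1 = w - 1 by omega, show w' + 2 - 1 = w' + 1 by omega, ha, hc])
      refine ⟨by omega, by omega, ?_⟩
      rw [hc, show w - 1 = 1 by omega, torusConway_one]
    -- The gap is positive and neither 2 nor 4, whereas exponents from the two supports can coincide
    -- only for a gap in `{0, ±2, ±4}`. The supports are thus disjoint, and equality would make
    -- every coefficient zero.
    · refine absurd ?_ (threeBraidPoly_ne_zero w N)
      ext1 k
      have e := hk k
      rw [← coeff_threeBraidPoly] at e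
      by_cases hkw : k = w - 2 ∨ k = w ∨ k = w + 2
      · rw [e, if_neg (by omega), if_neg (by omega), if_neg (by omega)]; simp
      · rw [coeff_threeBraidPoly, if_neg (by omega), if_neg (by omega), if_neg (by omega)]; simp
  · rintro (rfl | ⟨rfl, rfl⟩ | ⟨rfl, rfl, rfl⟩)
    · rfl
    -- With `N = C_{w'+1}` the top term for `w' + 2` and the bottom term for `w'` vanish. The
    -- recursion matches the remaining terms, in degrees `w'` and `w' + 2`.
    · have h1 := torusConway_add_one (w' + 1 + 1)
      have h2 := torusConway_add_one (w' + 1)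
      have h3 := torusConway_add_one w'
      simp only [add_sub_cancel_right] at h1 h2
      have e1 : w' + 2 = w' + 1 + 1 := by ring
      simp only [threeBraidPoly, e1, add_sub_cancel_right, h1, h2, h3, sub_self, map_zero, zero_mul,
        show w' + 1 + 1 - 2 = w' by ring, add_zero, zero_add]
      congr 1
      · congr 2; ring
      · congr 2; ring
    -- Here both polynomials reduce to `z²`, the value for the unknot. The recursion run backwards
    -- from `C_0` and `C_{-1}` supplies `C_{-3}`.
    · have h3 : torusConway (-3) = LaurentPolynomial.T 1 ^ 2 + 1 := by
        have e1 := torusConway_add_one (-1)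
        have e2 := torusConway_add_one (-2)
        norm_num [torusConway_zero, torusConway_neg_one] at e1 e2
        linear_combination LaurentPolynomial.T 1 * e1 - e2
      norm_num [threeBraidPoly, torusConway_three, torusConway_one, torusConway_neg_one, h3]
      have hC : (C 2 : LaurentVZ) = 2 := map_ofNat _ 2
      ring_nf
      simp [hC]

theorem homflypt_eq_iff_threeBraidPoly_eq {β γ : BraidGroup 3} :
    homflypt β = homflypt γ ↔
      threeBraidPoly (writhe β) (conway β) = threeBraidPoly (writhe γ) (conway γ) := by
  -- Since `z` is a unit, the factor `z²` can be cancelled.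
  have hz : IsUnit (LaurentVZ.z ^ 2) := ((LaurentPolynomial.isUnit_T (R := ℤ) 1).map
    (C : LaurentPolynomial ℤ →+* LaurentVZ)).pow 2
  rw [← homflypt_threeBraid, ← homflypt_threeBraid, hz.mul_right_inj]

end BraidGroup

/-- When do the closures of two 3-braids have the same Homflypt polynomial? -/
theorem mainTheorem7 (β γ : BraidGroup 3)
    (hw : BraidGroup.writhe γ ≤ BraidGroup.writhe β) :
    BraidGroup.homflypt β = BraidGroup.homflypt γ ↔
      BraidGroup.conway β = BraidGroup.conway γ ∧
        (BraidGroup.writhe β = BraidGroup.writhe γ ∨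
          (BraidGroup.writhe β = BraidGroup.writhe γ + 2 ∧
            BraidGroup.conway β = BraidGroup.torusConway (BraidGroup.writhe β - 1)) ∨
          (BraidGroup.writhe β = 2 ∧ BraidGroup.writhe γ = -2 ∧
            BraidGroup.conway β = 1)) := by
  rw [BraidGroup.homflypt_eq_iff_threeBraidPoly_eq]
  by_cases hN : BraidGroup.conway β = BraidGroup.conway γ
  · rw [← hN, BraidGroup.threeBraidPoly_eq_iff hw]
    exact (and_iff_right rfl).symm
  -- With different Conway polynomials both sides are false: the specialization `v = 1` would turn
  -- equal Homflypt polynomials into equal Conway polynomials.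
  · rw [← BraidGroup.homflypt_eq_iff_threeBraidPoly_eq]
    refine ⟨fun h => absurd (congrArg LaurentVZ.atOne h) hN, fun h => absurd h.1 hN⟩
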